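/- Let $X$ be a $\sigma$-finite measure space, let $A$ be a (possibly unbounded) self-adjoint operator on the complex Hilbert space $L^2(X)$, let $2<q<\infty$ and $1/q+1/q'=1$. For a bounded Borel function $f:\mathbb R\to\mathbb C$ let $f(A)$ be given by the Borel functional calculus; in particular $\Pi_{[a,b]}=\mathbf 1_{[a,b]}(A)$, and $(A^2-z)^{-1}$, $(A^2-z)^{-\beta}$ are defined for $z\in\mathbb C\setminus\mathbb R$, the latter with the principal branch of the power. For a bounded operator $T$ on $L^2(X)$ let $\operatorname{Im}T=(T-T^*)/(2i)$ and let $$\|T\|_{L^{q'}\to L^{r}}=\sup\{\|Tu\|_{L^r}:u\in L^2(X)\cap L^{q'}(X),\ \|u\|_{L^{q'}}\le 1\}\in[0,\infty].$$ Write $\langle x\rangle=2+|x|$. For $0<\epsilon\le\lambda$ put $$S=\sup\{\|\Pi_{[\epsilon k,\epsilon(k+1)]}\|_{L^{q'}\to L^2}: k\in\mathbb Z,\ 0\le k\le 2\lambda/\epsilon\}.$$ There are an absolute constant $C_0$, constants $C_1(c)$ depending only on $c>0$, and constants $C_2(c,\beta)$ depending only on $c>0$ and $\beta>1$ (in particular,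 none depends on $X,A,q,\lambda,\epsilon,\mu$) such that, for all $X$, $A$, $q$ as above and all $0<\epsilon\le\lambda$, $$\|\Pi_{[\lambda,\lambda+\epsilon]}\|_{L^{q'}\to L^2}\le C_0\,\epsilon\lambda\,\|\Pi_{[0,2\lambda]}\operatorname{Im}(A^2-(\lambda+i\epsilon)^2)^{-1}\|_{L^{q'}\to L^2},$$ $$\|\Pi_{[0,2\lambda]}(A^2-(\lambda+i\epsilon)^2)^{-1}\|_{L^{q'}\to L^2}\le C_0(\epsilon\lambda)^{-1}S,$$ $$\|\Pi_{[\lambda,\lambda+\epsilon]}\|_{L^{q'}\to L^2}^2\le C_0\,\epsilon\lambda\,\|\Pi_{[0,2\lambda]}\operatorname{Im}(A^2-(\lambda+i\epsilon)^2)^{-1}\|_{L^{q'}\to L^q},$$ $$\|\Pi_{[0,2\lambda]}(A^2-(\lambda+i\epsilon)^2)^{-1}\|_{L^{q'}\to L^q}\le C_0(\epsilon\lambda)^{-1}\ln\langle\lambda/\epsilon\rangle\,S^2,$$ and moreover, for all $c>0$, all $\mu\ge c\,\epsilon$ and all $\beta>1$, $$\|\Pi_{[0,2\lambda]}(A^2-(\lambda+i\mu)^2)^{-1}\|_{L^{q'}\to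 L^q}\le C_1(c)\,(\epsilon\lambda)^{-1}\langle\mu/\lambda\rangle^{-1}\ln\langle\lambda/\mu\rangle\,S^2,$$ $$\|\Pi_{[0,2\lambda]}(A^2-(\lambda+i\mu)^2)^{-\beta}\|_{L^{q'}\to L^q}\le C_2(c,\beta)\,(\epsilon\lambda)^{-\beta}(\epsilon/\mu)^{\beta-1}\langle\mu/\lambda\rangle^{-\beta}\,S^2.$$ -/

import Mathlib

open MeasureTheory Filter Topology
open scoped NNReal ENNReal ComplexStarModule

noncomputable section

section Calculus

variable {H : Type*} [NormedAddCommGroup H] [InnerProductSpace ℂ H] [CompleteSpace H]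

/-- A bounded Borel function `ℝ → ℂ`. -/
def IsBddBorel (f : ℝ → ℂ) : Prop :=
  Measurable f ∧ ∃ M : ℝ, ∀ t, ‖f t‖ ≤ M

/-- `Φ` is the bounded Borel functional calculus `f ↦ f(A)` of the (possibly unbounded) operator
`A` on the Hilbert space `H`: on the bounded Borel functions it is a unital `*`-homomorphism into
the bounded operators, it is contractive for the sup norm, it turns bounded pointwise convergence
into strong convergence, and it sends `t ↦ (t - z)⁻¹`, for nonreal `z`, to the resolvent
`(A - z)⁻¹`.

For a self-adjoint `A` the spectral theorem says that there is such a `Φ`, and that it is unique on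
the bounded Borel functions. -/
structure IsBorelCalculus (A : H →ₗ.[ℂ] H) (Φ : (ℝ → ℂ) → H →L[ℂ] H) : Prop where
  map_one : Φ (fun _ => 1) = 1
  map_add : ∀ f g, IsBddBorel f → IsBddBorel g → Φ (fun t => f t + g t) = Φ f + Φ g
  map_smul : ∀ (c : ℂ) (f), IsBddBorel f → Φ (fun t => c * f t) = c • Φ f
  map_mul : ∀ f g, IsBddBorel f → IsBddBorel g → Φ (fun t => f t * g t) = Φ f * Φ g
  map_conj : ∀ f, IsBddBorel f → Φ (fun t => starRingEnd ℂ (f t)) = star (Φ f)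
  norm_le : ∀ (f) (M : ℝ), Measurable f → (∀ t, ‖f t‖ ≤ M) → ‖Φ f‖ ≤ M
  tendsto : ∀ (F : ℕ → ℝ → ℂ) (f : ℝ → ℂ) (M : ℝ), (∀ n, Measurable (F n)) →
    (∀ n t, ‖F n t‖ ≤ M) → (∀ t, Tendsto (fun n => F n t) atTop (𝓝 (f t))) →
    ∀ u : H, Tendsto (fun n => Φ (F n) u) atTop (𝓝 (Φ f u))
  resolvent : ∀ z : ℂ, z.im ≠ 0 → ∀ u : H, ∃ h : Φ (fun t => ((t : ℂ) - z)⁻¹) u ∈ A.domain,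
    A ⟨Φ (fun t => ((t : ℂ) - z)⁻¹) u, h⟩ - z • Φ (fun t => ((t : ℂ) - z)⁻¹) u = u

open Classical in
/-- The operator `f(A)`, for a self-adjoint operator `A` and a bounded Borel function `f`. -/
def borelCalculus (A : H →ₗ.[ℂ] H) (f : ℝ → ℂ) : H →L[ℂ] H :=
  if h : ∃ Φ, IsBorelCalculus A Φ then h.choose f else 0

/-- The spectral projection `Π_{[a,b]} = 𝟏_{[a,b]}(A)`. -/
def specProj (A : H →ₗ.[ℂ] H) (a b : ℝ) : H →L[ℂ] H :=
  borelCalculus A ((Set.Icc a b).indicator fun _ => 1)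

/-- The resolvent `(A² - z)⁻¹` of `A²`, for nonreal `z`. -/
def sqResolvent (A : H →ₗ.[ℂ] H) (z : ℂ) : H →L[ℂ] H :=
  borelCalculus A fun t => ((t : ℂ) ^ 2 - z)⁻¹

/-- The power `(A² - z)^{-β}`, for nonreal `z` (principal branch). -/
def sqResolventPow (A : H →ₗ.[ℂ] H) (z : ℂ) (β : ℝ) : H →L[ℂ] H :=
  borelCalculus A fun t => ((t : ℂ) ^ 2 - z) ^ (-(β : ℂ))

end Calculus

/-- The norm of `T` as an operator `L^p(X) → L^r(X)`, initially defined on `L² ∩ L^p`: the supremum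
of `‖T u‖_{L^r}` over `u ∈ L² ∩ L^p` with `‖u‖_{L^p} ≤ 1`. It is `∞` if `T` is not bounded from
`L² ∩ L^p`, with the norm of `L^p`, to `L^r`. -/
def opNormLp {X : Type*} [MeasurableSpace X] {ν : Measure X} (p r : ℝ≥0∞)
    (T : Lp ℂ 2 ν →L[ℂ] Lp ℂ 2 ν) : ℝ≥0∞ :=
  ⨆ (u : Lp ℂ 2 ν) (_ : eLpNorm u p ν ≤ 1), eLpNorm (T u) r ν

/-- The bracket `⟨x⟩ = 2 + |x|`. -/
def bracket (x : ℝ) : ℝ := 2 + |x|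

/-- `sup_k ‖Π_{[εk, ε(k+1)]}‖_{L^p → L²}` over the integers `0 ≤ k ≤ 2λ/ε`. -/
def supCluster {X : Type*} [MeasurableSpace X] {ν : Measure X} (p : ℝ≥0∞)
    (A : Lp ℂ 2 ν →ₗ.[ℂ] Lp ℂ 2 ν) (lam eps : ℝ) : ℝ≥0∞ :=
  ⨆ (k : ℕ) (_ : (k : ℝ) ≤ 2 * lam / eps),
    opNormLp p 2 (specProj A (eps * k) (eps * (k + 1)))

end

/-!
The spectral theorem turns every operator here into a function of `A`, so the estimates reduce to
inequalities between functions on `ℝ`, together with duality between `L^q` and `L^{q'}`.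

*Bounds for the projection on `[λ, λ + ε]`.* On this interval the imaginary part of
`(t² - (λ + iε)²)⁻¹` is at least `(10 ελ)⁻¹`, and it is nonnegative everywhere. Hence `𝟏_{[λ, λ+ε]}`
is at most `10 ελ` times the truncated imaginary part. Pointwise domination of symbols gives
domination of the vectors `f(A) u` (`IsBorelCalculus.norm_apply_le`) and of the quadratic forms
(`IsBorelCalculus.norm_apply_sq_le`). The latter, with Hölder's inequality for the form, gives the
bound by the norm from `L^{q'}` to `L^q`.

*Bounds for the resolvent and its powers.* A symbol `g` supported in `[0, 2λ]` is cut into the cells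
`[εk, ε(k+1))`. On each cell `g(A)` factors through the spectral projection on both sides, so that
`|⟨g(A) u, v⟩| ≤ ∑ₖ aₖ ‖Πₖ u‖ ‖Πₖ v‖` when `|g| ≤ aₖ` on the `k`-th cell
(`IsBorelCalculus.norm_inner_le_sum`). With the converse of Hölder's inequality
(`eLpNorm_le_of_forall_norm_inner_le`) this bounds the norm from `L^{q'}` to `L^q` by `S² ∑ aₖ`, and
applied to `|g|²` it bounds the norm from `L^{q'}` to `L²` by `S (∑ aₖ²)^{1/2}`. If `j` cells lie
between the cells of `t` and of `λ`, then `|t² - (λ + iμ)²|` is at least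
`ελ⟨μ/λ⟩ (j + μ/ε) / 6` (`mul_cellGap_add_le_norm`), so the sums are comparable to
`∑ (j + μ/ε)^{-β}` over `0 ≤ j ≤ 2λ/ε`, and these are compared with integrals: a logarithm for
`β = 1`, a power of `μ/ε` for `β > 1`.
-/

/-! ### Bounded Borel functions and their functional calculus -/

section Calculus

variable {H : Type*} [NormedAddCommGroup H] [InnerProductSpace ℂ H] [CompleteSpace H]

namespace IsBddBorel

variable {f g : ℝ → ℂ}

theorem const (c : ℂ) : IsBddBorel fun _ => c :=
  ⟨measurable_const, ‖c‖, fun _ => le_rfl⟩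

theorem mul (hf : IsBddBorel f) (hg : IsBddBorel g) : IsBddBorel fun t => f t * g t := by
  obtain ⟨hf, M, hM⟩ := hf
  obtain ⟨hg, N, hN⟩ := hg
  refine ⟨hf.mul hg, M * N, fun t => ?_⟩
  rw [norm_mul]
  exact mul_le_mul (hM t) (hN t) (norm_nonneg _) ((norm_nonneg _).trans (hM t))

theorem add (hf : IsBddBorel f) (hg : IsBddBorel g) : IsBddBorel fun t => f t + g t := by
  obtain ⟨hf, M, hM⟩ := hf
  obtain ⟨hg, N, hN⟩ := hg
  exact ⟨hf.add hg, M + N, fun t => (norm_add_le _ _).trans (add_le_add (hM t) (hN t))⟩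

theorem conj (hf : IsBddBorel f) : IsBddBorel fun t => starRingEnd ℂ (f t) := by
  obtain ⟨hf, M, hM⟩ := hf
  exact ⟨Complex.continuous_conj.measurable.comp hf, M, fun t => by simpa using hM t⟩

theorem indicator (hf : IsBddBorel f) {s : Set ℝ} (hs : MeasurableSet s) :
    IsBddBorel (s.indicator f) := by
  obtain ⟨hf, M, hM⟩ := hf
  exact ⟨hf.indicator hs, M, fun t => (norm_indicator_le_norm_self _ _).trans (hM t)⟩

theorem sum {ι : Type*} (s : Finset ι) {F : ι → ℝ → ℂ} (hF : ∀ i ∈ s, IsBddBorel (F i)) :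
    IsBddBorel fun t => ∑ i ∈ s, F i t := by
  classical
  induction s using Finset.induction_on with
  | empty => simpa using const 0
  | insert i s hi ih =>
    simp only [Finset.sum_insert hi]
    exact (hF i (by simp)).add (ih fun j hj => hF j (by simp [hj]))

end IsBddBorel

namespace IsBorelCalculus

variable {A : H →ₗ.[ℂ] H} {Φ : (ℝ → ℂ) → H →L[ℂ] H}

theorem map_sum (hΦ : IsBorelCalculus A Φ) {ι : Type*} (s : Finset ι) {F : ι → ℝ → ℂ}
    (hF : ∀ i ∈ s, IsBddBorel (F i)) : Φ (fun t => ∑ i ∈ s, F i t) = ∑ i ∈ s, Φ (F i) := by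
  classical
  induction s using Finset.induction_on with
  | empty => simpa using hΦ.map_smul 0 _ (.const 0)
  | insert i s hi ih =>
    have hs : ∀ j ∈ s, IsBddBorel (F j) := fun j hj => hF j (by simp [hj])
    simp only [Finset.sum_insert hi]
    rw [hΦ.map_add _ _ (hF i (by simp)) (.sum s hs), ih hs]

/-- Pointwise domination of functions gives domination of the operators applied to a vector. -/
theorem norm_apply_le (hΦ : IsBorelCalculus A Φ) {f g : ℝ → ℂ} (hf : IsBddBorel f)
    (hg : IsBddBorel g) {M : ℝ} (hM : 0 ≤ M) (h : ∀ t, ‖f t‖ ≤ M * ‖g t‖) (u : H) :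
    ‖Φ f u‖ ≤ M * ‖Φ g u‖ := by
  -- `f = (f / g) g` also where `g` vanishes, since there `f` vanishes too.
  have hle : ∀ t, ‖f t / g t‖ ≤ M := fun t => by
    rw [norm_div]
    exact div_le_of_le_mul₀ (norm_nonneg _) hM (h t)
  have hfg : f = fun t => f t / g t * g t := by
    funext t
    by_cases h0 : g t = 0
    · simpa [h0] using h t
    · rw [div_mul_cancel₀ _ h0]
  have hmeas : Measurable fun t => f t / g t := hf.1.div hg.1
  rw [hfg, hΦ.map_mul _ _ ⟨hmeas, M, hle⟩ hg, mul_apply_eq_comp]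
  exact (ContinuousLinearMap.le_opNorm _ _).trans
    (mul_le_mul_of_nonneg_right (hΦ.norm_le _ M hmeas hle) (norm_nonneg _))

theorem norm_apply_sq (hΦ : IsBorelCalculus A Φ) {f : ℝ → ℂ} (hf : IsBddBorel f) (u : H) :
    ‖Φ f u‖ ^ 2 = ‖inner ℂ (Φ (fun t => starRingEnd ℂ (f t) * f t) u) u‖ := by
  rw [hΦ.map_mul _ _ hf.conj hf, hΦ.map_conj _ hf, ContinuousLinearMap.star_eq_adjoint,
    mul_apply_eq_comp, ContinuousLinearMap.adjoint_inner_left,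
    inner_self_eq_norm_sq_to_K]
  simp

/-- The quadratic form of `g(A)` controls `‖f(A) u‖²` when `g ≥ 0` dominates `|f|²`. -/
theorem norm_apply_sq_le (hΦ : IsBorelCalculus A Φ) {f : ℝ → ℂ} {g : ℝ → ℝ} (hf : IsBddBorel f)
    (hg : IsBddBorel fun t => (g t : ℂ)) (hg0 : ∀ t, 0 ≤ g t) {M : ℝ} (hM : 0 ≤ M)
    (h : ∀ t, ‖f t‖ ^ 2 ≤ M * g t) (u : H) :
    ‖Φ f u‖ ^ 2 ≤ M * ‖inner ℂ (Φ (fun t => (g t : ℂ)) u) u‖ := by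
  have hgm : Measurable g := Complex.measurable_re.comp hg.1
  have hs : IsBddBorel fun t => ((√(g t) : ℝ) : ℂ) := by
    obtain ⟨-, N, hN⟩ := hg
    refine ⟨Complex.measurable_ofReal.comp hgm.sqrt, √N, fun t => ?_⟩
    rw [Complex.norm_real, Real.norm_of_nonneg (Real.sqrt_nonneg _)]
    refine Real.sqrt_le_sqrt ((le_abs_self _).trans ?_)
    simpa using hN t
  have key := hΦ.norm_apply_le hf hs (Real.sqrt_nonneg M) (fun t => by
    rw [Complex.norm_real, Real.norm_of_nonneg (Real.sqrt_nonneg _), ← Real.sqrt_mul hM]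
    exact Real.le_sqrt_of_sq_le (h t)) u
  calc ‖Φ f u‖ ^ 2 ≤ (√M * ‖Φ (fun t => ((√(g t) : ℝ) : ℂ)) u‖) ^ 2 := by gcongr
    _ = M * ‖inner ℂ (Φ (fun t => (g t : ℂ)) u) u‖ := by
      rw [mul_pow, Real.sq_sqrt hM, hΦ.norm_apply_sq hs]
      congr 5
      funext t
      rw [Complex.conj_ofReal, ← Complex.ofReal_mul, Real.mul_self_sqrt (hg0 t)]

/-- If `g` is bounded by `a` and vanishes off `E`, then `g(A) = 𝟏_E(A) g(A) 𝟏_E(A)`, and the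
sesquilinear form of `g(A)` only sees the spectral projections of the two vectors on `E`. -/
theorem norm_inner_le (hΦ : IsBorelCalculus A Φ) {g : ℝ → ℂ} (hg : Measurable g) {E : Set ℝ}
    (hE : MeasurableSet E) {a : ℝ} (ha : ∀ t, ‖g t‖ ≤ a) (hgE : ∀ t ∉ E, g t = 0) (u v : H) :
    ‖inner ℂ (Φ g u) v‖ ≤
      a * (‖Φ (E.indicator fun _ => 1) u‖ * ‖Φ (E.indicator fun _ => 1) v‖) := by
  have hb : IsBddBorel g := ⟨hg, a, ha⟩
  have hp : IsBddBorel (E.indicator fun _ => (1 : ℂ)) := (IsBddBorel.const 1).indicator hE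
  have hstar : star (Φ (E.indicator fun _ => 1)) = Φ (E.indicator fun _ => 1) := by
    rw [← hΦ.map_conj _ hp]
    congr 1
    funext t
    by_cases ht : t ∈ E <;> simp [ht]
  have hfac : Φ g = star (Φ (E.indicator fun _ => 1)) * (Φ g * Φ (E.indicator fun _ => 1)) := by
    rw [hstar, ← hΦ.map_mul _ _ hb hp, ← hΦ.map_mul _ _ hp (hb.mul hp)]
    congr 1
    funext t
    by_cases ht : t ∈ E
    · simp [ht]
    · simp [hgE t ht]
  rw [hfac, ContinuousLinearMap.star_eq_adjoint, mul_apply_eq_comp,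
    ContinuousLinearMap.adjoint_inner_left, mul_apply_eq_comp]
  refine (norm_inner_le_norm _ _).trans ?_
  rw [← mul_assoc]
  gcongr
  exact (ContinuousLinearMap.le_opNorm _ _).trans
    (mul_le_mul_of_nonneg_right (hΦ.norm_le _ a hg ha) (norm_nonneg _))

/-- Cutting a function supported in `[0, Λ]` into the cells `[εk, ε(k+1))` bounds its sesquilinear
form by the spectral projections on the closed cells. -/
theorem norm_inner_le_sum (hΦ : IsBorelCalculus A Φ) {g : ℝ → ℂ} (hg : IsBddBorel g)
    {Λ ε : ℝ} (hε : 0 < ε) (hsupp : ∀ t ∉ Set.Icc 0 Λ, g t = 0) {a : ℕ → ℝ} (ha0 : ∀ k, 0 ≤ a k)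
    (ha : ∀ k : ℕ, ∀ t ∈ Set.Icc 0 Λ, ε * k ≤ t → t < ε * (k + 1) → ‖g t‖ ≤ a k) (u v : H) :
    ‖inner ℂ (Φ g u) v‖ ≤ ∑ k ∈ Finset.range (⌊Λ / ε⌋₊ + 1),
      a k * (‖Φ ((Set.Icc (ε * k) (ε * (k + 1))).indicator fun _ => 1) u‖ *
        ‖Φ ((Set.Icc (ε * k) (ε * (k + 1))).indicator fun _ => 1) v‖) := by
  have hdec : g = fun t => ∑ k ∈ Finset.range (⌊Λ / ε⌋₊ + 1),
      (Set.Ico (ε * k) (ε * (k + 1))).indicator g t := by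
    funext t
    by_cases ht : t ∈ Set.Icc 0 Λ
    · have h0 : 0 ≤ t / ε := div_nonneg ht.1 hε.le
      rw [Finset.sum_eq_single ⌊t / ε⌋₊, Set.indicator_of_mem]
      · have h1 := Nat.floor_le h0
        have h2 := Nat.lt_floor_add_one (t / ε)
        rw [le_div_iff₀ hε] at h1
        rw [div_lt_iff₀ hε] at h2
        exact ⟨by linarith, by linarith⟩
      · intro k _ hk
        refine Set.indicator_of_notMem (fun hmem => hk ?_) _
        refine ((Nat.floor_eq_iff h0).2 ⟨?_, ?_⟩).symm
        · rw [le_div_iff₀ hε]; linarith [hmem.1]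
        · rw [div_lt_iff₀ hε]; linarith [hmem.2]
      · intro hnot
        refine absurd (Finset.mem_range.2 (Nat.lt_succ_of_le (Nat.floor_mono ?_))) hnot
        gcongr
        exact ht.2
    · have h0 := hsupp t ht
      rw [h0]
      refine (Finset.sum_eq_zero fun k _ => ?_).symm
      by_cases hk : t ∈ Set.Ico (ε * (k : ℝ)) (ε * (k + 1)) <;> simp [hk, h0]
  have hb : ∀ k ∈ Finset.range (⌊Λ / ε⌋₊ + 1),
      IsBddBorel ((Set.Ico (ε * (k : ℝ)) (ε * (k + 1))).indicator g) :=
    fun k _ => hg.indicator measurableSet_Ico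
  rw [hdec, hΦ.map_sum _ hb, sum_apply, sum_inner]
  refine (norm_sum_le _ _).trans (Finset.sum_le_sum fun k hk => ?_)
  refine hΦ.norm_inner_le (hb k hk).1 measurableSet_Icc (fun t => ?_) (fun t ht => ?_) u v
  · by_cases hk : t ∈ Set.Ico (ε * (k : ℝ)) (ε * (k + 1))
    · rw [Set.indicator_of_mem hk]
      by_cases ht : t ∈ Set.Icc 0 Λ
      · exact ha k t ht hk.1 hk.2
      · simpa [hsupp t ht] using ha0 k
    · simpa [Set.indicator_of_notMem hk] using ha0 k
  · exact Set.indicator_of_notMem (fun h => ht ⟨h.1, h.2.le⟩) _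

/-- The operator imaginary part `(T - T*) / 2i` of `f(A)` is `(Im f)(A)`. -/
theorem imaginaryPart_eq (hΦ : IsBorelCalculus A Φ) {f : ℝ → ℂ} (hf : IsBddBorel f) :
    (ℑ (Φ f) : H →L[ℂ] H) = Φ fun t => ((f t).im : ℂ) := by
  have h : (fun t => ((f t).im : ℂ)) =
      fun t => (-Complex.I / 2) * (f t + (-1) * starRingEnd ℂ (f t)) := by
    funext t
    apply Complex.ext <;> simp
    ring
  rw [h, hΦ.map_smul _ _ (hf.add ((IsBddBorel.const (-1)).mul hf.conj)),
    hΦ.map_add _ _ hf ((IsBddBorel.const (-1)).mul hf.conj), hΦ.map_smul _ _ hf.conj,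
    hΦ.map_conj _ hf, imaginaryPart_apply_coe, ← Complex.coe_smul, smul_smul]
  congr 1
  · push_cast; ring
  · simp [sub_eq_add_neg]

end IsBorelCalculus
end Calculus

/-! ### Duality of Lebesgue norms and operators on `L²` -/

section Lebesgue

variable {X : Type*} [MeasurableSpace X] {ν : Measure X}

@[simp]
theorem opNormLp_zero (p r : ℝ≥0∞) : opNormLp p r (0 : Lp ℂ 2 ν →L[ℂ] Lp ℂ 2 ν) = 0 := by
  refine le_antisymm (iSup₂_le fun u _ => ?_) bot_le
  rw [zero_apply, eLpNorm_congr_ae (Lp.coeFn_zero ℂ 2 ν), eLpNorm_zero]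

/-- Homogeneity: `opNormLp` is defined through the unit ball, and bounds `T` on every vector of finite
`L^p` norm. -/
theorem eLpNorm_apply_le_opNormLp {p r : ℝ≥0∞} (hp : p ≠ 0) (T : Lp ℂ 2 ν →L[ℂ] Lp ℂ 2 ν)
    {u : Lp ℂ 2 ν} (hu : eLpNorm u p ν ≠ ∞) :
    eLpNorm (T u) r ν ≤ opNormLp p r T * eLpNorm u p ν := by
  by_cases h0 : eLpNorm u p ν = 0
  · rw [eLpNorm_eq_zero_iff (Lp.aestronglyMeasurable u) hp] at h0
    have : u = 0 := (Lp.eq_zero_iff_ae_eq_zero).2 h0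
    rw [this, map_zero, eLpNorm_congr_ae (Lp.coeFn_zero ℂ 2 ν), eLpNorm_zero]
    exact bot_le
  set c : ℝ := (eLpNorm u p ν).toReal with hc
  have hcpos : 0 < c := ENNReal.toReal_pos h0 hu
  have hcn : eLpNorm u p ν = ‖(c : ℂ)‖ₑ := by
    rw [← ofReal_norm, Complex.norm_real, Real.norm_of_nonneg hcpos.le, hc, ENNReal.ofReal_toReal hu]
  have hc0 : (c : ℂ) ≠ 0 := by exact_mod_cast hcpos.ne'
  have hv : eLpNorm ((c : ℂ)⁻¹ • u : Lp ℂ 2 ν) p ν ≤ 1 := by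
    rw [eLpNorm_congr_ae (Lp.coeFn_smul _ _), eLpNorm_const_smul, hcn, ← enorm_mul,
      inv_mul_cancel₀ hc0]
    simp
  have hu' : T u = (c : ℂ) • T ((c : ℂ)⁻¹ • u) := by
    rw [map_smul, smul_inv_smul₀ hc0]
  rw [hu', eLpNorm_congr_ae (Lp.coeFn_smul _ _), eLpNorm_const_smul, hcn, mul_comm]
  gcongr
  exact le_iSup₂_of_le _ hv le_rfl

theorem opNormLp_le {p r : ℝ≥0∞} {T : Lp ℂ 2 ν →L[ℂ] Lp ℂ 2 ν} {C : ℝ≥0∞}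
    (h : ∀ u : Lp ℂ 2 ν, eLpNorm u p ν ≤ 1 → eLpNorm (T u) r ν ≤ C) : opNormLp p r T ≤ C :=
  iSup₂_le h

theorem norm_apply_le_opNormLp {p : ℝ≥0∞} (hp : p ≠ 0) {T : Lp ℂ 2 ν →L[ℂ] Lp ℂ 2 ν}
    {u : Lp ℂ 2 ν} (hu : eLpNorm u p ν ≠ ∞) {S : ℝ≥0∞} (hS : S ≠ ∞) (hT : opNormLp p 2 T ≤ S) :
    ‖T u‖ ≤ S.toReal * (eLpNorm u p ν).toReal := by
  rw [← ENNReal.toReal_mul, ← toReal_enorm, Lp.enorm_def]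
  refine ENNReal.toReal_mono (ENNReal.mul_ne_top hS hu) ?_
  exact (eLpNorm_apply_le_opNormLp hp T hu).trans (by gcongr)

theorem enorm_inner_le_eLpNorm_mul_eLpNorm (q q' : ℝ≥0∞) [ENNReal.HolderConjugate q q']
    (w v : Lp ℂ 2 ν) : ‖inner ℂ w v‖ₑ ≤ eLpNorm w q ν * eLpNorm v q' ν := by
  rw [L2.inner_def]
  refine (enorm_integral_le_lintegral_enorm _).trans ?_
  rw [← eLpNorm_one_eq_lintegral_enorm]
  simpa using eLpNorm_le_eLpNorm_mul_eLpNorm_of_nnnorm (p := q) (q := q') (r := 1)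
    (Lp.aestronglyMeasurable w) (Lp.aestronglyMeasurable v) (fun a b : ℂ => inner ℂ a b) 1
    (.of_forall fun x => by simpa using nnnorm_inner_le_nnnorm (𝕜 := ℂ) (w x) (v x))

/-- The converse of Hölder's inequality, tested on `L²`. For `q ≥ 2` the extremal functions
`w |w|^{q-2}`, cut off to where `|w| ≤ n`, lie in `L² ∩ L^{q'}` because `w ∈ L²`, so that neither
`w ∈ L^q` nor a restriction on the measure has to be assumed. -/
theorem eLpNorm_le_of_forall_norm_inner_le {q q' : ℝ≥0∞} [ENNReal.HolderConjugate q q']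
    (hq2 : 2 ≤ q) (hq : q ≠ ∞) {w : Lp ℂ 2 ν} {M : ℝ} (hM : 0 ≤ M)
    (h : ∀ v : Lp ℂ 2 ν, eLpNorm v q' ν ≠ ∞ →
      ‖inner ℂ w v‖ ≤ M * (eLpNorm v q' ν).toReal) :
    eLpNorm w q ν ≤ ENNReal.ofReal M := by
  have hq0 : q ≠ 0 := (zero_lt_two.trans_le hq2).ne'
  have hq1 : 1 < q := ENNReal.one_lt_two.trans_le hq2
  have hq'1 : 1 ≤ q' := ENNReal.HolderConjugate.one_le q' q
  have hq' : q' ≠ ∞ := ((ENNReal.HolderConjugate.lt_top_iff_one_lt q' q).2 hq1).ne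
  have hq'0 : q' ≠ 0 := (zero_lt_one.trans_le hq'1).ne'
  have hconj := ENNReal.HolderConjugate.toReal_of_ne_top (p := q) (q := q') hq hq'
  set r := q.toReal with hr
  set r' := q'.toReal with hr'
  have hr2 : 2 ≤ r := by simpa using ENNReal.toReal_mono hq hq2
  have hwm : StronglyMeasurable w := Lp.stronglyMeasurable w
  let E : ℕ → Set X := fun n => {x | ‖w x‖ ≤ n}
  have hE : ∀ n, MeasurableSet (E n) := fun n =>
    measurableSet_le hwm.norm.measurable measurable_const
  have hEmono : Monotone E := fun m n hmn x hx =>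
    le_trans (show ‖w x‖ ≤ m from hx) (by exact_mod_cast hmn)
  have hEU : ⋃ n, E n = Set.univ := Set.eq_univ_of_forall fun x =>
    Set.mem_iUnion.2 (exists_nat_ge ‖w x‖)
  have hbound : ∀ n, ∫⁻ x in E n, ‖w x‖ₑ ^ r ∂ν ≤ ENNReal.ofReal M ^ r := by
    intro n
    let φ : X → ℂ := (E n).indicator fun x => ((‖w x‖ ^ (r - 2) : ℝ) : ℂ) * w x
    have hφm : StronglyMeasurable φ :=
      ((Complex.measurable_ofReal.comp (hwm.norm.measurable.pow_const _)).mul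
        hwm.measurable).stronglyMeasurable.indicator (hE n)
    have hφ2 : MemLp φ 2 ν := by
      refine (Lp.memLp w).of_le_mul (c := (n : ℝ) ^ (r - 2)) hφm.aestronglyMeasurable
        (.of_forall fun x => ?_)
      by_cases hx : x ∈ E n
      · simp only [φ, Set.indicator_of_mem hx, norm_mul, Complex.norm_real]
        rw [Real.norm_of_nonneg (by positivity)]
        exact mul_le_mul_of_nonneg_right
          (Real.rpow_le_rpow (norm_nonneg _) hx (by linarith)) (norm_nonneg _)
      · simp only [φ, Set.indicator_of_notMem hx, norm_zero]
        positivity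
    let F : X → ℝ≥0∞ := (E n).indicator fun x => ‖w x‖ₑ ^ r
    have hFm : Measurable F := (hwm.enorm.pow_const r).indicator (hE n)
    have hFtop : ∀ x, F x ≠ ∞ := fun x => by
      by_cases hx : x ∈ E n
      · simp only [F, Set.indicator_of_mem hx]
        exact ENNReal.rpow_ne_top_of_nonneg (by linarith) enorm_ne_top
      · simp [F, Set.indicator_of_notMem hx]
    have hφw : ∀ x, inner ℂ (w x) (φ x) = ((F x).toReal : ℂ) := by
      intro x
      by_cases hx : x ∈ E n
      · simp only [φ, F, Set.indicator_of_mem hx]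
        rw [← ENNReal.toReal_rpow, toReal_enorm]
        by_cases h0 : w x = 0
        · simp [h0, Real.zero_rpow (by linarith : r ≠ 0)]
        · have : (0 : ℝ) < ‖w x‖ := norm_pos_iff.2 h0
          rw [RCLike.inner_apply, mul_assoc, RCLike.mul_conj]
          have hpow : ‖w x‖ ^ r = ‖w x‖ ^ (r - 2) * ‖w x‖ ^ 2 := by
            rw [← Real.rpow_natCast, ← Real.rpow_add this]
            norm_num
          rw [hpow]
          push_cast
          rfl
      · simp [φ, F, Set.indicator_of_notMem hx]
    have hφr : ∀ x, ‖φ x‖ₑ ^ r' = F x := by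
      intro x
      by_cases hx : x ∈ E n
      · simp only [φ, F, Set.indicator_of_mem hx]
        have h1 : ‖(((‖w x‖ ^ (r - 2) : ℝ) : ℂ) * w x)‖ₑ = ‖w x‖ₑ ^ (r - 1) := by
          rw [enorm_mul, ← ofReal_norm ((‖w x‖ ^ (r - 2) : ℝ) : ℂ), Complex.norm_real,
            Real.norm_of_nonneg (by positivity),
            ← ENNReal.ofReal_rpow_of_nonneg (norm_nonneg _) (by linarith), ofReal_norm]
          nth_rw 2 [← ENNReal.rpow_one ‖w x‖ₑ]
          rw [← ENNReal.rpow_add_of_nonneg _ _ (by linarith) zero_le_one]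
          congr 1
          ring
        rw [h1, ← ENNReal.rpow_mul, hconj.sub_one_mul_conj]
      · simp [φ, F, Set.indicator_of_notMem hx, ENNReal.zero_rpow_of_pos hconj.symm.pos]
    set I : ℝ≥0∞ := ∫⁻ x in E n, ‖w x‖ₑ ^ r ∂ν with hI
    have hIF : I = ∫⁻ x, F x ∂ν := (lintegral_indicator (hE n) _).symm
    have hinner : (fun x => inner ℂ (w x) (hφ2.toLp φ x)) =ᵐ[ν] fun x => ((F x).toReal : ℂ) := by
      filter_upwards [hφ2.coeFn_toLp] with x hx
      rw [hx, hφw]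
    have hItop : I ≠ ∞ := by
      have hint := ((L2.integrable_inner (𝕜 := ℂ) w (hφ2.toLp φ)).congr hinner).2.ne
      have heq : ∀ x, ‖((F x).toReal : ℂ)‖ₑ = F x := fun x => by
        rw [← ofReal_norm, Complex.norm_real, Real.norm_of_nonneg ENNReal.toReal_nonneg,
          ENNReal.ofReal_toReal (hFtop x)]
      simpa only [heq, ← hIF] using hint
    have hφq : eLpNorm φ q' ν = I ^ (1 / r') := by
      rw [eLpNorm_eq_lintegral_rpow_enorm_toReal hq'0 hq', hIF]
      simp only [← hr', hφr]
    have hpair : inner ℂ w (hφ2.toLp φ) = ((I.toReal : ℝ) : ℂ) := by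
      rw [L2.inner_def, integral_congr_ae hinner, integral_complex_ofReal, hIF,
        integral_toReal hFm.aemeasurable (.of_forall fun x => (hFtop x).lt_top)]
    have hcoe : eLpNorm (hφ2.toLp φ) q' ν = I ^ (1 / r') := by
      rw [eLpNorm_congr_ae hφ2.coeFn_toLp, hφq]
    have key := h (hφ2.toLp φ) (by
      rw [hcoe]; exact ENNReal.rpow_ne_top_of_nonneg (by positivity) hItop)
    rw [hpair, hcoe, ← ENNReal.toReal_rpow, Complex.norm_real,
      Real.norm_of_nonneg ENNReal.toReal_nonneg] at key
    rcases eq_or_lt_of_le (ENNReal.toReal_nonneg (a := I)) with h0 | hpos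
    · rcases (ENNReal.toReal_eq_zero_iff I).1 h0.symm with h1 | h1
      · rw [h1]; exact bot_le
      · exact absurd h1 hItop
    · have hle : I.toReal ^ (1 / r) ≤ M := by
        have hsplit : I.toReal = I.toReal ^ (1 / r) * I.toReal ^ (1 / r') := by
          rw [← Real.rpow_add hpos, one_div, one_div, hconj.inv_add_inv_eq_one, Real.rpow_one]
        refine le_of_mul_le_mul_right ?_ (Real.rpow_pos_of_pos hpos (1 / r'))
        rwa [← hsplit]
      rw [← ENNReal.ofReal_toReal hItop, ENNReal.ofReal_rpow_of_nonneg hM (by linarith)]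
      refine ENNReal.ofReal_le_ofReal ?_
      rwa [one_div, Real.rpow_inv_le_iff_of_pos hpos.le hM (by linarith)] at hle
  have hlim : ∫⁻ x, ‖w x‖ₑ ^ r ∂ν ≤ ENNReal.ofReal M ^ r := by
    rw [← setLIntegral_univ, ← hEU, setLIntegral_iUnion_of_directed _ hEmono.directed_le]
    exact iSup_le hbound
  rw [eLpNorm_eq_lintegral_rpow_enorm_toReal hq0 hq, ← hr, one_div,
    ENNReal.rpow_inv_le_iff (by linarith)]
  exact hlim

end Lebesgue

/-! ### Sums over cells of the symbol of the resolvent -/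

section Scalar

/-- Factor `t² - (λ + iμ)² = (t + λ + iμ)(t - λ - iμ)`: for `t ≥ 0` the first factor is of size at
least `max(λ, μ)`, the second of size at least `max(|t - λ|, μ)`. -/
theorem le_norm_sq_sub_sq {t lam mu : ℝ} (ht : 0 ≤ t) (hlam : 0 < lam) (hmu : 0 < mu) :
    (2 * lam + mu) / 6 * (|t - lam| + mu) ≤ ‖(t : ℂ) ^ 2 - (lam + Complex.I * mu) ^ 2‖ := by
  have hfac : (t : ℂ) ^ 2 - (lam + Complex.I * mu) ^ 2 =
      (t + lam + Complex.I * mu) * (t - lam - Complex.I * mu) := by ring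
  have h1 : |t + lam| ≤ ‖(t + lam + Complex.I * mu : ℂ)‖ := by
    simpa using Complex.abs_re_le_norm (t + lam + Complex.I * mu : ℂ)
  have h2 : |mu| ≤ ‖(t + lam + Complex.I * mu : ℂ)‖ := by
    simpa using Complex.abs_im_le_norm (t + lam + Complex.I * mu : ℂ)
  have h3 : |t - lam| ≤ ‖(t - lam - Complex.I * mu : ℂ)‖ := by
    simpa using Complex.abs_re_le_norm (t - lam - Complex.I * mu : ℂ)
  have h4 : |mu| ≤ ‖(t - lam - Complex.I * mu : ℂ)‖ := by
    simpa using Complex.abs_im_le_norm (t - lam - Complex.I * mu : ℂ)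
  rw [abs_of_pos hmu] at h2 h4
  rw [abs_of_nonneg (by positivity)] at h1
  rw [hfac, norm_mul]
  calc (2 * lam + mu) / 6 * (|t - lam| + mu)
      = (2 * lam + mu) / 3 * ((|t - lam| + mu) / 2) := by ring
    _ ≤ _ := mul_le_mul (by linarith) (by linarith) (by positivity) (norm_nonneg _)

/-- The bound by the imaginary part holds for all `t` and makes the symbols bounded on `ℝ`. -/
theorem two_mul_le_norm_sq_sub_sq (t : ℝ) {lam mu : ℝ} (hlam : 0 < lam) (hmu : 0 < mu) :
    2 * lam * mu ≤ ‖(t : ℂ) ^ 2 - (lam + Complex.I * mu) ^ 2‖ := by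
  have h := Complex.abs_im_le_norm ((t : ℂ) ^ 2 - (lam + Complex.I * mu) ^ 2)
  have him : ((t : ℂ) ^ 2 - (lam + Complex.I * mu) ^ 2).im = -(2 * lam * mu) := by
    simp [pow_two]
    ring
  rw [him, abs_neg, abs_of_pos (by positivity)] at h
  exact h

theorem im_inv_sq_sub_sq (t lam eps : ℝ) :
    (((t : ℂ) ^ 2 - (lam + Complex.I * eps) ^ 2)⁻¹).im =
      2 * lam * eps / ((t ^ 2 - lam ^ 2 + eps ^ 2) ^ 2 + (2 * lam * eps) ^ 2) := by
  have hre : ((t : ℂ) ^ 2 - (lam + Complex.I * eps) ^ 2).re = t ^ 2 - lam ^ 2 + eps ^ 2 := by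
    simp [pow_two]
    ring
  have him : ((t : ℂ) ^ 2 - (lam + Complex.I * eps) ^ 2).im = -(2 * lam * eps) := by
    simp [pow_two]
    ring
  rw [Complex.inv_im, Complex.normSq_apply, hre, him]
  congr 1 <;> ring

theorem one_le_mul_im_inv {t lam eps : ℝ} (heps : 0 < eps) (hle : eps ≤ lam)
    (ht : t ∈ Set.Icc lam (lam + eps)) :
    1 ≤ 10 * (eps * lam) * (((t : ℂ) ^ 2 - (lam + Complex.I * eps) ^ 2)⁻¹).im := by
  have hlam : 0 < lam := heps.trans_le hle
  obtain ⟨h1, h2⟩ := ht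
  have hp : 0 < eps * lam := mul_pos heps hlam
  have h0 : 0 ≤ t ^ 2 - lam ^ 2 + eps ^ 2 := by nlinarith
  have h4 : t ^ 2 - lam ^ 2 + eps ^ 2 ≤ 4 * (eps * lam) := by nlinarith
  have hsq : (t ^ 2 - lam ^ 2 + eps ^ 2) ^ 2 ≤ (4 * (eps * lam)) ^ 2 := by gcongr
  rw [im_inv_sq_sub_sq, ← mul_div_assoc, one_le_div (by positivity)]
  nlinarith

/-- The number of cells `[εj, ε(j+1))` that lie strictly between the `k`-th cell and the `n`-th, that
is `max(|k - n| - 1, 0)`: of the two truncated differences at most one is nonzero. -/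
def cellGap (n k : ℕ) : ℕ := (n - 1 - k) + (k - n - 1)

theorem mul_cellGap_le {t lam eps : ℝ} (heps : 0 < eps) (hlam : 0 ≤ lam) {k : ℕ}
    (h1 : eps * k ≤ t) (h2 : t < eps * (k + 1)) :
    eps * cellGap ⌊lam / eps⌋₊ k ≤ |t - lam| := by
  have h3 := Nat.floor_le (div_nonneg hlam heps.le)
  have h4 := Nat.lt_floor_add_one (lam / eps)
  rw [le_div_iff₀ heps] at h3
  rw [div_lt_iff₀ heps] at h4
  generalize ⌊lam / eps⌋₊ = n at *
  rcases lt_trichotomy k n with h | h | h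
  · obtain ⟨d, rfl⟩ := Nat.exists_eq_add_of_lt h
    have : cellGap (k + d + 1) k = d := by unfold cellGap; omega
    rw [this, abs_sub_comm]
    refine le_trans ?_ (le_abs_self _)
    push_cast at h3
    linarith
  · have : cellGap n k = 0 := by unfold cellGap; omega
    simp [this]
  · obtain ⟨d, rfl⟩ := Nat.exists_eq_add_of_lt h
    have : cellGap n (n + d + 1) = d := by unfold cellGap; omega
    rw [this]
    refine le_trans ?_ (le_abs_self _)
    push_cast at h1
    linarith

/-- Each gap is attained at most twice, except that gap `0` is attained by the `n`-th cell and by its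
two neighbours. -/
theorem sum_cellGap_le {G : ℕ → ℝ} (hG : ∀ i, 0 ≤ G i) {n N : ℕ} (hn : n ≤ N) :
    ∑ k ∈ Finset.range (N + 1), G (cellGap n k) ≤
      3 * G 0 + 2 * ∑ i ∈ Finset.range N, G (i + 1) := by
  have hmono : ∀ {a b : ℕ}, a ≤ b → ∑ i ∈ Finset.range a, G i ≤ ∑ i ∈ Finset.range b, G i :=
    fun hab => Finset.sum_le_sum_of_subset_of_nonneg (Finset.range_mono hab) fun i _ _ => hG i
  have hlow : ∑ k ∈ Finset.range n, G (cellGap n k) = ∑ i ∈ Finset.range n, G i := by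
    rw [← Finset.sum_range_reflect G n]
    refine Finset.sum_congr rfl fun k hk => ?_
    rw [Finset.mem_range] at hk
    congr 1
    unfold cellGap
    omega
  have hhigh : ∑ k ∈ Finset.Ico n (N + 1), G (cellGap n k) =
      (∑ i ∈ Finset.range (N - n), G i) + G 0 := by
    rw [Finset.sum_Ico_eq_sum_range, Nat.succ_sub hn, Finset.sum_range_succ']
    congr 1
    · refine Finset.sum_congr rfl fun k _ => ?_
      congr 1
      unfold cellGap
      omega
    · congr 1
      unfold cellGap
      omega
  rw [← Finset.sum_range_add_sum_Ico _ (show n ≤ N + 1 by omega), hlow, hhigh]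
  have h1 := hmono (show n ≤ N + 1 by omega)
  have h2 := hmono (show N - n ≤ N + 1 by omega)
  rw [Finset.sum_range_succ'] at h1 h2
  linarith

theorem sum_rpow_neg_le_integral {s m : ℝ} (hs : 0 ≤ s) (hm : 0 < m) (N : ℕ) :
    ∑ i ∈ Finset.range N, (((i + 1 : ℕ) : ℝ) + m) ^ (-s) ≤ ∫ x in m..m + N, x ^ (-s) := by
  have hanti : AntitoneOn (fun x : ℝ => x ^ (-s)) (Set.Icc m (m + N)) := fun x hx y _ hxy =>
    Real.rpow_le_rpow_of_nonpos (hm.trans_le hx.1) hxy (by linarith)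
  simpa only [add_comm m] using hanti.sum_le_integral

theorem sum_cellGap_inv_le {c m : ℝ} (hc : 0 < c) (hcm : c ≤ m) {n N : ℕ} (hn : n ≤ N) :
    ∑ k ∈ Finset.range (N + 1), ((cellGap n k : ℝ) + m)⁻¹ ≤
      3 / c + 2 * Real.log (1 + N / m) := by
  have hm : 0 < m := hc.trans_le hcm
  refine (sum_cellGap_le (G := fun i => ((i : ℝ) + m)⁻¹) (fun i => by positivity) hn).trans ?_
  have h1 := sum_rpow_neg_le_integral zero_le_one hm N
  simp only [Real.rpow_neg_one] at h1
  rw [integral_inv_of_pos hm (by positivity), add_div, div_self hm.ne'] at h1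
  have h2 : m⁻¹ ≤ c⁻¹ := inv_anti₀ hc hcm
  simp only [Nat.cast_zero, zero_add, div_eq_mul_inv] at *
  linarith

theorem sum_cellGap_rpow_neg_le {c m β : ℝ} (hc : 0 < c) (hcm : c ≤ m) (hβ : 1 < β) {n N : ℕ}
    (hn : n ≤ N) :
    ∑ k ∈ Finset.range (N + 1), ((cellGap n k : ℝ) + m) ^ (-β) ≤
      (3 / c + 2 / (β - 1)) * m ^ (1 - β) := by
  have hm : 0 < m := hc.trans_le hcm
  refine (sum_cellGap_le (G := fun i => ((i : ℝ) + m) ^ (-β)) (fun i => by positivity) hn).trans ?_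
  have h1 := sum_rpow_neg_le_integral (zero_le_one.trans hβ.le) hm N
  have h0 : (0 : ℝ) ∉ Set.uIcc m (m + N) := by
    rw [Set.uIcc_of_le (by simp)]
    exact fun h => absurd h.1 (not_le.2 hm)
  rw [integral_rpow (Or.inr ⟨by linarith, h0⟩)] at h1
  have h2 : ((m + N) ^ (-β + 1) - m ^ (-β + 1)) / (-β + 1) ≤ m ^ (1 - β) / (β - 1) := by
    rw [← neg_div_neg_eq, neg_sub, show -(-β + 1) = β - 1 by ring, show -β + 1 = 1 - β by ring]
    have : 0 ≤ (m + N) ^ (1 - β) := by positivity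
    gcongr
    · linarith
  have h3 : m ^ (-β) ≤ m ^ (1 - β) / c := by
    rw [le_div_iff₀ hc, show 1 - β = -β + 1 by ring, Real.rpow_add_one hm.ne']
    gcongr
  have h4 : (3 / c + 2 / (β - 1)) * m ^ (1 - β) =
      3 * (m ^ (1 - β) / c) + 2 * (m ^ (1 - β) / (β - 1)) := by ring
  rw [h4]
  simp only [Nat.cast_zero, zero_add]
  linarith

end Scalar

/-! ### Operators cut into spectral cells -/

section SpectralCluster

variable {X : Type*} [MeasurableSpace X] {ν : Measure X}
  {A : Lp ℂ 2 ν →ₗ.[ℂ] Lp ℂ 2 ν} {Φ : (ℝ → ℂ) → Lp ℂ 2 ν →L[ℂ] Lp ℂ 2 ν}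

namespace IsBorelCalculus

/-- The form of `g(A)` for `g` of size at most `a k` on the `k`-th cell, in terms of a common bound `S`
for the spectral projections on the cells from `L^p` to `L²`. -/
theorem norm_inner_le_of_cells (hΦ : IsBorelCalculus A Φ) {p : ℝ≥0∞} (hp : p ≠ 0) {g : ℝ → ℂ}
    (hg : IsBddBorel g) {Λ ε : ℝ} (hΛ : 0 ≤ Λ) (hε : 0 < ε)
    (hsupp : ∀ t ∉ Set.Icc 0 Λ, g t = 0) {a : ℕ → ℝ} (ha0 : ∀ k, 0 ≤ a k)
    (ha : ∀ k : ℕ, ∀ t ∈ Set.Icc 0 Λ, ε * k ≤ t → t < ε * (k + 1) → ‖g t‖ ≤ a k)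
    {B : ℝ} (hB : ∑ k ∈ Finset.range (⌊Λ / ε⌋₊ + 1), a k ≤ B) {S : ℝ≥0∞} (hS : S ≠ ∞)
    (hcell : ∀ k : ℕ, (k : ℝ) ≤ Λ / ε →
      opNormLp p 2 (Φ ((Set.Icc (ε * k) (ε * (k + 1))).indicator fun _ => 1)) ≤ S)
    {u v : Lp ℂ 2 ν} (hu : eLpNorm u p ν ≠ ∞) (hv : eLpNorm v p ν ≠ ∞) :
    ‖inner ℂ (Φ g u) v‖ ≤
      B * (S.toReal * (eLpNorm u p ν).toReal * (S.toReal * (eLpNorm v p ν).toReal)) := by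
  refine (hΦ.norm_inner_le_sum hg hε hsupp ha0 ha u v).trans ?_
  refine le_trans ?_ (mul_le_mul_of_nonneg_right hB (by positivity))
  rw [Finset.sum_mul]
  refine Finset.sum_le_sum fun k hk => mul_le_mul_of_nonneg_left ?_ (ha0 k)
  have hkΛ : (k : ℝ) ≤ Λ / ε :=
    (Nat.le_floor_iff (by positivity)).1 (Nat.lt_succ_iff.1 (Finset.mem_range.1 hk))
  exact mul_le_mul (norm_apply_le_opNormLp hp hu hS (hcell k hkΛ))
    (norm_apply_le_opNormLp hp hv hS (hcell k hkΛ)) (norm_nonneg _) (by positivity)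

/-- The `TT*` bound from `L^{q'}` to `L^q`: the two vectors in the form of `g(A)` each contribute a
factor `S`, and the sizes of `g` on the cells add up. -/
theorem opNormLp_dual_le (hΦ : IsBorelCalculus A Φ) {q q' : ℝ≥0∞} [ENNReal.HolderConjugate q q']
    (hq2 : 2 ≤ q) (hq : q ≠ ∞) {g : ℝ → ℂ}
    (hg : IsBddBorel g) {Λ ε : ℝ} (hΛ : 0 ≤ Λ) (hε : 0 < ε)
    (hsupp : ∀ t ∉ Set.Icc 0 Λ, g t = 0) {a : ℕ → ℝ} (ha0 : ∀ k, 0 ≤ a k)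
    (ha : ∀ k : ℕ, ∀ t ∈ Set.Icc 0 Λ, ε * k ≤ t → t < ε * (k + 1) → ‖g t‖ ≤ a k)
    {B : ℝ} (hB0 : 0 < B) (hB : ∑ k ∈ Finset.range (⌊Λ / ε⌋₊ + 1), a k ≤ B) {S : ℝ≥0∞}
    (hcell : ∀ k : ℕ, (k : ℝ) ≤ Λ / ε →
      opNormLp q' 2 (Φ ((Set.Icc (ε * k) (ε * (k + 1))).indicator fun _ => 1)) ≤ S) :
    opNormLp q' q (Φ g) ≤ ENNReal.ofReal B * S ^ 2 := by
  have hq' : q' ≠ 0 := (zero_lt_one.trans_le (ENNReal.HolderConjugate.one_le q' q)).ne'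
  -- For `S = ∞` the right-hand side is `∞`, because `B` is positive.
  rcases eq_or_ne S ∞ with rfl | hS
  · simp [ENNReal.mul_top, hB0]
  refine opNormLp_le fun u hu => ?_
  have hut : eLpNorm u q' ν ≠ ∞ := ne_top_of_le_ne_top ENNReal.one_ne_top hu
  have hu1 : (eLpNorm u q' ν).toReal ≤ 1 := ENNReal.toReal_mono ENNReal.one_ne_top hu
  have hBS : ENNReal.ofReal B * S ^ 2 = ENNReal.ofReal (B * S.toReal ^ 2) := by
    rw [ENNReal.ofReal_mul hB0.le, ENNReal.ofReal_pow ENNReal.toReal_nonneg,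
      ENNReal.ofReal_toReal hS]
  rw [hBS]
  refine eLpNorm_le_of_forall_norm_inner_le (q' := q') hq2 hq (by positivity) fun v hv => ?_
  refine (hΦ.norm_inner_le_of_cells hq' hg hΛ hε hsupp ha0 ha hB hS hcell hut hv).trans ?_
  calc B * (S.toReal * (eLpNorm u q' ν).toReal * (S.toReal * (eLpNorm v q' ν).toReal))
      ≤ B * (S.toReal * 1 * (S.toReal * (eLpNorm v q' ν).toReal)) := by gcongr
    _ = B * S.toReal ^ 2 * (eLpNorm v q' ν).toReal := by ring

/-- The bound from `L^p` to `L²` applies the form estimate to `|g|²`, so that by the orthogonality of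
the cells the sizes of `g` add up in `ℓ²`. -/
theorem opNormLp_two_le (hΦ : IsBorelCalculus A Φ) {p : ℝ≥0∞} (hp : p ≠ 0) {g : ℝ → ℂ}
    (hg : IsBddBorel g) {Λ ε : ℝ} (hΛ : 0 ≤ Λ) (hε : 0 < ε)
    (hsupp : ∀ t ∉ Set.Icc 0 Λ, g t = 0) {a : ℕ → ℝ} (ha0 : ∀ k, 0 ≤ a k)
    (ha : ∀ k : ℕ, ∀ t ∈ Set.Icc 0 Λ, ε * k ≤ t → t < ε * (k + 1) → ‖g t‖ ^ 2 ≤ a k)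
    {B : ℝ} (hB0 : 0 < B) (hB : ∑ k ∈ Finset.range (⌊Λ / ε⌋₊ + 1), a k ≤ B ^ 2) {S : ℝ≥0∞}
    (hcell : ∀ k : ℕ, (k : ℝ) ≤ Λ / ε →
      opNormLp p 2 (Φ ((Set.Icc (ε * k) (ε * (k + 1))).indicator fun _ => 1)) ≤ S) :
    opNormLp p 2 (Φ g) ≤ ENNReal.ofReal B * S := by
  -- For `S = ∞` the right-hand side is `∞`, because `B` is positive.
  rcases eq_or_ne S ∞ with rfl | hS
  · simp [ENNReal.mul_top, hB0]
  refine opNormLp_le fun u hu => ?_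
  have hut : eLpNorm u p ν ≠ ∞ := ne_top_of_le_ne_top ENNReal.one_ne_top hu
  have hu1 : (eLpNorm u p ν).toReal ≤ 1 := ENNReal.toReal_mono ENNReal.one_ne_top hu
  have hBS : ENNReal.ofReal B * S = ENNReal.ofReal (B * S.toReal) := by
    rw [ENNReal.ofReal_mul hB0.le, ENNReal.ofReal_toReal hS]
  rw [hBS, ← Lp.enorm_def, ← ofReal_norm]
  refine ENNReal.ofReal_le_ofReal (le_of_sq_le_sq ?_ (by positivity))
  rw [hΦ.norm_apply_sq hg]
  refine (hΦ.norm_inner_le_of_cells hp (hg.conj.mul hg) hΛ hε (fun t ht => by simp [hsupp t ht])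
    ha0 (fun k t ht h1 h2 => ?_) hB hS hcell hut hut).trans ?_
  · simpa [pow_two] using ha k t ht h1 h2
  · calc B ^ 2 * (S.toReal * (eLpNorm u p ν).toReal * (S.toReal * (eLpNorm u p ν).toReal))
        ≤ B ^ 2 * (S.toReal * 1 * (S.toReal * 1)) := by gcongr
      _ = (B * S.toReal) ^ 2 := by ring

end IsBorelCalculus

end SpectralCluster

/-! ### The symbols of the resolvent and its powers -/

section Resolvent

theorem isBddBorel_sqResolvent {lam mu : ℝ} (hlam : 0 < lam) (hmu : 0 < mu) :
    IsBddBorel fun t => ((t : ℂ) ^ 2 - (lam + Complex.I * mu) ^ 2)⁻¹ := by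
  refine ⟨by fun_prop, (2 * lam * mu)⁻¹, fun t => ?_⟩
  rw [norm_inv]
  exact inv_anti₀ (by positivity) (two_mul_le_norm_sq_sub_sq t hlam hmu)

theorem isBddBorel_sqResolventPow {lam mu β : ℝ} (hlam : 0 < lam) (hmu : 0 < mu) (hβ : 0 ≤ β) :
    IsBddBorel fun t => ((t : ℂ) ^ 2 - (lam + Complex.I * mu) ^ 2) ^ (-(β : ℂ)) := by
  refine ⟨by fun_prop, (2 * lam * mu) ^ (-β), fun t => ?_⟩
  rw [← Complex.ofReal_neg, Complex.norm_cpow_real]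
  exact Real.rpow_le_rpow_of_nonpos (by positivity) (two_mul_le_norm_sq_sub_sq t hlam hmu)
    (by linarith)

/-- The distance from `t²` to `(λ + iμ)²`, for `t` in the `k`-th cell, grows linearly in the gap between
the cells of `t` and `λ`. -/
theorem mul_cellGap_add_le_norm {t lam eps mu : ℝ} (heps : 0 < eps) (hlam : 0 < lam)
    (hmu : 0 < mu) {k : ℕ} (ht : 0 ≤ t) (h1 : eps * k ≤ t) (h2 : t < eps * (k + 1)) :
    eps * lam * bracket (mu / lam) / 6 * (cellGap ⌊lam / eps⌋₊ k + mu / eps) ≤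
      ‖(t : ℂ) ^ 2 - (lam + Complex.I * mu) ^ 2‖ := by
  have hb : lam * bracket (mu / lam) = 2 * lam + mu := by
    rw [bracket, abs_of_pos (by positivity)]
    field_simp
  refine le_trans ?_ (le_norm_sq_sub_sq ht hlam hmu)
  have h := mul_cellGap_le heps hlam.le h1 h2
  have hrw : eps * lam * bracket (mu / lam) / 6 * (cellGap ⌊lam / eps⌋₊ k + mu / eps) =
      (2 * lam + mu) / 6 * (eps * cellGap ⌊lam / eps⌋₊ k + mu) := by
    rw [mul_assoc eps, hb]
    field_simp
  rw [hrw]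
  gcongr

theorem isBddBorel_im_indicator {lam eps : ℝ} (heps : 0 < eps) (hlam : 0 < lam) :
    IsBddBorel fun t => (((Set.Icc 0 (2 * lam)).indicator
      (fun t => (((t : ℂ) ^ 2 - (lam + Complex.I * eps) ^ 2)⁻¹).im) t : ℝ) : ℂ) := by
  obtain ⟨hm, M, hM⟩ :=
    (isBddBorel_sqResolvent hlam heps).indicator (measurableSet_Icc (a := 0) (b := 2 * lam))
  have h : ∀ t, (Set.Icc 0 (2 * lam)).indicator
      (fun t => (((t : ℂ) ^ 2 - (lam + Complex.I * eps) ^ 2)⁻¹).im) t =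
      ((Set.Icc 0 (2 * lam)).indicator
        (fun t => ((t : ℂ) ^ 2 - (lam + Complex.I * eps) ^ 2)⁻¹) t).im := fun t => by
    by_cases ht : t ∈ Set.Icc 0 (2 * lam) <;> simp [ht]
  simp only [h]
  refine ⟨Complex.measurable_ofReal.comp (Complex.measurable_im.comp hm), M, fun t => ?_⟩
  rw [Complex.norm_real]
  exact (Complex.abs_im_le_norm _).trans (hM t)

theorem im_indicator_nonneg {lam eps : ℝ} (heps : 0 < eps) (hlam : 0 < lam) (t : ℝ) :
    0 ≤ (Set.Icc 0 (2 * lam)).indicator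
      (fun t : ℝ => (((t : ℂ) ^ 2 - (lam + Complex.I * eps) ^ 2)⁻¹).im) t := by
  refine Set.indicator_nonneg (fun t _ => ?_) t
  rw [im_inv_sq_sub_sq]
  positivity

/-- The lower bound behind both restriction estimates: the truncated imaginary part of the resolvent
is of size `(ελ)⁻¹` on all of `[λ, λ + ε]`. The truncation to `[0, 2λ]` keeps this interval because
`ε ≤ λ`. -/
theorem indicator_le_im {lam eps : ℝ} (heps : 0 < eps) (hle : eps ≤ lam) (t : ℝ) :
    ‖(Set.Icc lam (lam + eps)).indicator (fun _ => (1 : ℂ)) t‖ ≤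
      10 * (eps * lam) * (Set.Icc 0 (2 * lam)).indicator
        (fun t : ℝ => (((t : ℂ) ^ 2 - (lam + Complex.I * eps) ^ 2)⁻¹).im) t := by
  have hlam : 0 < lam := heps.trans_le hle
  by_cases ht : t ∈ Set.Icc lam (lam + eps)
  · have ht' : t ∈ Set.Icc 0 (2 * lam) := ⟨by linarith [ht.1], by linarith [ht.2]⟩
    rw [Set.indicator_of_mem ht, Set.indicator_of_mem ht', norm_one]
    exact one_le_mul_im_inv heps hle ht
  · rw [Set.indicator_of_notMem ht, norm_zero]
    exact mul_nonneg (by positivity) (im_indicator_nonneg heps hlam t)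

end Resolvent

/-! ### Estimates for spectral projections and resolvents -/

namespace IsBorelCalculus

variable {X : Type*} [MeasurableSpace X] {ν : Measure X}
  {A : Lp ℂ 2 ν →ₗ.[ℂ] Lp ℂ 2 ν} {Φ : (ℝ → ℂ) → Lp ℂ 2 ν →L[ℂ] Lp ℂ 2 ν} {lam eps : ℝ}

theorem indicator_mul (hΦ : IsBorelCalculus A Φ) {f : ℝ → ℂ} (hf : IsBddBorel f) {E : Set ℝ}
    (hE : MeasurableSet E) : Φ (E.indicator fun _ => 1) * Φ f = Φ (E.indicator f) := by
  rw [← hΦ.map_mul _ _ ((IsBddBorel.const 1).indicator hE) hf]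
  congr 1
  funext t
  by_cases ht : t ∈ E <;> simp [ht]

theorem indicator_mul_imaginaryPart (hΦ : IsBorelCalculus A Φ) (heps : 0 < eps)
    (hlam : 0 < lam) :
    Φ ((Set.Icc 0 (2 * lam)).indicator fun _ => 1) *
      (ℑ (Φ fun t => ((t : ℂ) ^ 2 - (lam + Complex.I * eps) ^ 2)⁻¹) :
        Lp ℂ 2 ν →L[ℂ] Lp ℂ 2 ν) =
    Φ fun t => (((Set.Icc 0 (2 * lam)).indicator
      (fun t => (((t : ℂ) ^ 2 - (lam + Complex.I * eps) ^ 2)⁻¹).im) t : ℝ) : ℂ) := by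
  have hr := isBddBorel_sqResolvent hlam heps
  have hi : IsBddBorel fun t =>
      ((((t : ℂ) ^ 2 - (lam + Complex.I * eps) ^ 2)⁻¹).im : ℂ) := by
    obtain ⟨hm, M, hM⟩ := hr
    refine ⟨Complex.measurable_ofReal.comp (Complex.measurable_im.comp hm), M, fun t => ?_⟩
    rw [Complex.norm_real]
    exact (Complex.abs_im_le_norm _).trans (hM t)
  rw [hΦ.imaginaryPart_eq hr, hΦ.indicator_mul hi measurableSet_Icc]
  congr 1
  funext t
  by_cases ht : t ∈ Set.Icc 0 (2 * lam) <;> simp [ht]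

theorem opNormLp_specProj_le (hΦ : IsBorelCalculus A Φ) (p : ℝ≥0∞) (heps : 0 < eps)
    (hle : eps ≤ lam) :
    opNormLp p 2 (Φ ((Set.Icc lam (lam + eps)).indicator fun _ => 1)) ≤
      ENNReal.ofReal (10 * (eps * lam)) *
        opNormLp p 2 (Φ fun t => (((Set.Icc 0 (2 * lam)).indicator
          (fun t => (((t : ℂ) ^ 2 - (lam + Complex.I * eps) ^ 2)⁻¹).im) t : ℝ) : ℂ)) := by
  have hlam : 0 < lam := heps.trans_le hle
  refine opNormLp_le fun u hu => ?_
  have h := hΦ.norm_apply_le (M := 10 * (eps * lam))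
    ((IsBddBorel.const 1).indicator (measurableSet_Icc (a := lam) (b := lam + eps)))
    (isBddBorel_im_indicator heps hlam) (by positivity) (fun t => by
      rw [Complex.norm_real, Real.norm_of_nonneg (im_indicator_nonneg heps hlam t)]
      exact indicator_le_im heps hle t) u
  have h' := ENNReal.ofReal_le_ofReal h
  rw [ENNReal.ofReal_mul (by positivity), ofReal_norm, ofReal_norm, Lp.enorm_def,
    Lp.enorm_def] at h'
  refine h'.trans ?_
  gcongr
  exact le_iSup₂_of_le u hu le_rfl

theorem opNormLp_specProj_sq_le (hΦ : IsBorelCalculus A Φ) (q q' : ℝ≥0∞)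
    [ENNReal.HolderConjugate q q'] (heps : 0 < eps) (hle : eps ≤ lam) :
    opNormLp q' 2 (Φ ((Set.Icc lam (lam + eps)).indicator fun _ => 1)) ^ 2 ≤
      ENNReal.ofReal (10 * (eps * lam)) *
        opNormLp q' q (Φ fun t => (((Set.Icc 0 (2 * lam)).indicator
          (fun t => (((t : ℂ) ^ 2 - (lam + Complex.I * eps) ^ 2)⁻¹).im) t : ℝ) : ℂ)) := by
  have hlam : 0 < lam := heps.trans_le hle
  set T := Φ fun t => (((Set.Icc 0 (2 * lam)).indicator
    (fun t => (((t : ℂ) ^ 2 - (lam + Complex.I * eps) ^ 2)⁻¹).im) t : ℝ) : ℂ) with hT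
  -- The square is moved to the right-hand side as a square root, to be proved vector by vector.
  rw [← ENNReal.rpow_natCast, ← ENNReal.le_rpow_inv_iff (by norm_num)]
  refine opNormLp_le fun u hu => ?_
  rw [ENNReal.le_rpow_inv_iff (by norm_num), ENNReal.rpow_natCast]
  have h := hΦ.norm_apply_sq_le (M := 10 * (eps * lam))
    ((IsBddBorel.const 1).indicator (measurableSet_Icc (a := lam) (b := lam + eps)))
    (isBddBorel_im_indicator heps hlam) (im_indicator_nonneg heps hlam) (by positivity)
    (fun t => by
      refine le_trans ?_ (indicator_le_im heps hle t)
      by_cases ht : t ∈ Set.Icc lam (lam + eps) <;> simp [ht]) u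
  have h' := ENNReal.ofReal_le_ofReal h
  rw [ENNReal.ofReal_mul (by positivity), ENNReal.ofReal_pow (norm_nonneg _), ofReal_norm,
    ofReal_norm, Lp.enorm_def, ← hT] at h'
  refine h'.trans ?_
  gcongr
  calc ‖inner ℂ (T u) u‖ₑ ≤ eLpNorm (T u) q ν * eLpNorm u q' ν :=
        enorm_inner_le_eLpNorm_mul_eLpNorm q q' _ _
    _ ≤ eLpNorm (T u) q ν * 1 := by gcongr
    _ ≤ opNormLp q' q T := by
        rw [mul_one]
        exact le_iSup₂_of_le u hu le_rfl

/-- By `mul_cellGap_add_le_norm` with `μ = ε`, the squares of the sizes of the resolvent on the cells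
sum like `∑ (j + 1)⁻²`. -/
theorem opNormLp_two_resolvent_le (hΦ : IsBorelCalculus A Φ) {p : ℝ≥0∞} (hp : p ≠ 0)
    (heps : 0 < eps) (hle : eps ≤ lam) {S : ℝ≥0∞}
    (hcell : ∀ k : ℕ, (k : ℝ) ≤ 2 * lam / eps →
      opNormLp p 2 (Φ ((Set.Icc (eps * k) (eps * (k + 1))).indicator fun _ => 1)) ≤ S) :
    opNormLp p 2 (Φ ((Set.Icc 0 (2 * lam)).indicator
      fun t => ((t : ℂ) ^ 2 - (lam + Complex.I * eps) ^ 2)⁻¹)) ≤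
      ENNReal.ofReal (7 * (eps * lam)⁻¹) * S := by
  have hlam : 0 < lam := heps.trans_le hle
  set D : ℝ := eps * lam * bracket (eps / lam) / 6 with hD
  have hb : 2 ≤ bracket (eps / lam) := by simp [bracket]
  have hDle : eps * lam / 3 ≤ D := by
    have := mul_le_mul_of_nonneg_left hb (by positivity : 0 ≤ eps * lam)
    rw [hD]; linarith
  have hD0 : 0 < D := lt_of_lt_of_le (by positivity) hDle
  refine hΦ.opNormLp_two_le hp
    ((isBddBorel_sqResolvent hlam heps).indicator measurableSet_Icc) (by positivity) heps
    (fun t ht => Set.indicator_of_notMem ht _)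
    (a := fun k => D⁻¹ ^ 2 * ((cellGap ⌊lam / eps⌋₊ k : ℝ) + 1) ^ (-2 : ℝ))
    (fun k => by positivity) (fun k t ht h1 h2 => ?_) (by positivity) ?_ hcell
  · have h := mul_cellGap_add_le_norm heps hlam heps ht.1 h1 h2
    rw [div_self heps.ne', ← hD] at h
    rw [Set.indicator_of_mem ht, norm_inv, Real.rpow_neg (by positivity),
      show (2 : ℝ) = ((2 : ℕ) : ℝ) by norm_num, Real.rpow_natCast, ← inv_pow, ← mul_pow, ← mul_inv]
    gcongr
  · rw [← Finset.mul_sum]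
    have hn : ⌊lam / eps⌋₊ ≤ ⌊2 * lam / eps⌋₊ := Nat.floor_mono (by gcongr; linarith)
    have h := sum_cellGap_rpow_neg_le one_pos le_rfl one_lt_two hn
    rw [Real.one_rpow, show (3 / 1 + 2 / (2 - 1) : ℝ) * 1 = 5 by norm_num] at h
    have h3 : D⁻¹ ≤ 3 * (eps * lam)⁻¹ := by
      rw [← div_eq_mul_inv, ← inv_div]
      exact inv_anti₀ (by positivity) hDle
    calc D⁻¹ ^ 2 * _ ≤ (3 * (eps * lam)⁻¹) ^ 2 * 5 := by gcongr
      _ ≤ (7 * (eps * lam)⁻¹) ^ 2 := by nlinarith [sq_nonneg (eps * lam)⁻¹]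

/-- The sizes of the resolvent on the cells sum like `∑ (j + μ/ε)⁻¹` over `j ≤ 2λ/ε`, which produces
the logarithm of `1 + 2λ/μ`. -/
theorem opNormLp_dual_resolvent_le (hΦ : IsBorelCalculus A Φ) {q q' : ℝ≥0∞}
    [ENNReal.HolderConjugate q q'] (hq2 : 2 ≤ q) (hq : q ≠ ∞) (heps : 0 < eps) (hlam : 0 < lam)
    {c mu : ℝ} (hc : 0 < c) (hmu : c * eps ≤ mu) {S : ℝ≥0∞}
    (hcell : ∀ k : ℕ, (k : ℝ) ≤ 2 * lam / eps →
      opNormLp q' 2 (Φ ((Set.Icc (eps * k) (eps * (k + 1))).indicator fun _ => 1)) ≤ S) :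
    opNormLp q' q (Φ ((Set.Icc 0 (2 * lam)).indicator
      fun t => ((t : ℂ) ^ 2 - (lam + Complex.I * mu) ^ 2)⁻¹)) ≤
      ENNReal.ofReal (6 * (6 / c + 4) * ((eps * lam)⁻¹ * (bracket (mu / lam))⁻¹ *
        Real.log (bracket (lam / mu)))) * S ^ 2 := by
  have hmu0 : 0 < mu := lt_of_lt_of_le (by positivity) hmu
  set D : ℝ := eps * lam * bracket (mu / lam) / 6 with hD
  have hb : 2 ≤ bracket (mu / lam) := by simp [bracket]
  have hD0 : 0 < D := by positivity
  have hb' : bracket (lam / mu) = 2 + lam / mu := by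
    rw [bracket, abs_of_pos (by positivity)]
  have hx : 0 < lam / mu := by positivity
  have hlog2 : 1 / 2 ≤ Real.log (bracket (lam / mu)) := by
    have h1 : Real.log 2 ≤ Real.log (bracket (lam / mu)) :=
      Real.log_le_log two_pos (by rw [hb']; linarith)
    linarith [Real.log_two_gt_d9]
  refine hΦ.opNormLp_dual_le hq2 hq
    ((isBddBorel_sqResolvent hlam hmu0).indicator measurableSet_Icc) (by positivity) heps
    (fun t ht => Set.indicator_of_notMem ht _)
    (a := fun k => D⁻¹ * ((cellGap ⌊lam / eps⌋₊ k : ℝ) + mu / eps)⁻¹)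
    (fun k => by positivity) (fun k t ht h1 h2 => ?_) (by positivity) ?_ hcell
  · have h := mul_cellGap_add_le_norm heps hlam hmu0 ht.1 h1 h2
    rw [Set.indicator_of_mem ht, norm_inv, ← mul_inv]
    exact inv_anti₀ (by positivity) h
  · rw [← Finset.mul_sum]
    have hn : ⌊lam / eps⌋₊ ≤ ⌊2 * lam / eps⌋₊ := Nat.floor_mono (by gcongr; linarith)
    have h := sum_cellGap_inv_le hc ((le_div_iff₀ heps).2 hmu) hn
    have hN : (⌊2 * lam / eps⌋₊ : ℝ) / (mu / eps) ≤ 2 * (lam / mu) := by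
      calc (⌊2 * lam / eps⌋₊ : ℝ) / (mu / eps) ≤ (2 * lam / eps) / (mu / eps) := by
            gcongr
            exact Nat.floor_le (by positivity)
        _ = 2 * (lam / mu) := by field_simp
    -- `1 + 2x ≤ (2 + x)²` absorbs the constant into the bracket, at the price of a factor `2`.
    have hlog : Real.log (1 + ⌊2 * lam / eps⌋₊ / (mu / eps)) ≤
        2 * Real.log (bracket (lam / mu)) := by
      rw [← Nat.cast_two, ← Real.log_pow, Nat.cast_two]
      refine Real.log_le_log (by positivity) ?_
      rw [hb']
      nlinarith
    have h3 : 3 / c ≤ 6 / c * Real.log (bracket (lam / mu)) := by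
      have := mul_le_mul_of_nonneg_left hlog2 (by positivity : 0 ≤ 6 / c)
      calc 3 / c = 6 / c * (1 / 2) := by ring
        _ ≤ _ := this
    calc D⁻¹ * _ ≤ D⁻¹ * ((6 / c + 4) * Real.log (bracket (lam / mu))) := by
          gcongr
          linarith
      _ = _ := by
          rw [hD, inv_div, div_eq_mul_inv, mul_inv]
          ring

/-- For `β > 1` the sum `∑ (j + μ/ε)^{-β}` converges and is of size `(μ/ε)^{1-β}`. -/
theorem opNormLp_dual_resolventPow_le (hΦ : IsBorelCalculus A Φ) {q q' : ℝ≥0∞}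
    [ENNReal.HolderConjugate q q'] (hq2 : 2 ≤ q) (hq : q ≠ ∞) (heps : 0 < eps) (hlam : 0 < lam)
    {c mu : ℝ} (hc : 0 < c) (hmu : c * eps ≤ mu) {β : ℝ} (hβ : 1 < β) {S : ℝ≥0∞}
    (hcell : ∀ k : ℕ, (k : ℝ) ≤ 2 * lam / eps →
      opNormLp q' 2 (Φ ((Set.Icc (eps * k) (eps * (k + 1))).indicator fun _ => 1)) ≤ S) :
    opNormLp q' q (Φ ((Set.Icc 0 (2 * lam)).indicator
      fun t => ((t : ℂ) ^ 2 - (lam + Complex.I * mu) ^ 2) ^ (-(β : ℂ)))) ≤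
      ENNReal.ofReal (6 ^ β * (3 / c + 2 / (β - 1)) * ((eps * lam) ^ (-β) *
        (eps / mu) ^ (β - 1) * (bracket (mu / lam)) ^ (-β))) * S ^ 2 := by
  have hmu0 : 0 < mu := lt_of_lt_of_le (by positivity) hmu
  set D : ℝ := eps * lam * bracket (mu / lam) / 6 with hD
  have hb : 2 ≤ bracket (mu / lam) := by simp [bracket]
  have hD0 : 0 < D := by positivity
  have hβ1 : 0 < β - 1 := by linarith
  refine hΦ.opNormLp_dual_le hq2 hq
    ((isBddBorel_sqResolventPow hlam hmu0 (by linarith)).indicator measurableSet_Icc)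
    (by positivity) heps (fun t ht => Set.indicator_of_notMem ht _)
    (a := fun k => D ^ (-β) * ((cellGap ⌊lam / eps⌋₊ k : ℝ) + mu / eps) ^ (-β))
    (fun k => by positivity) (fun k t ht h1 h2 => ?_) (by positivity) ?_ hcell
  · have h := mul_cellGap_add_le_norm heps hlam hmu0 ht.1 h1 h2
    rw [Set.indicator_of_mem ht, ← Complex.ofReal_neg, Complex.norm_cpow_real,
      ← Real.mul_rpow hD0.le (by positivity)]
    exact Real.rpow_le_rpow_of_nonpos (by positivity) h (by linarith)
  · rw [← Finset.mul_sum]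
    have hn : ⌊lam / eps⌋₊ ≤ ⌊2 * lam / eps⌋₊ := Nat.floor_mono (by gcongr; linarith)
    have h := sum_cellGap_rpow_neg_le hc ((le_div_iff₀ heps).2 hmu) hβ hn
    have hDβ : D ^ (-β) = 6 ^ β * (eps * lam) ^ (-β) * (bracket (mu / lam)) ^ (-β) := by
      rw [hD, div_eq_mul_inv, Real.mul_rpow (by positivity) (by norm_num),
        Real.mul_rpow (by positivity) (by positivity), Real.inv_rpow (by norm_num),
        Real.rpow_neg (by norm_num : (0 : ℝ) ≤ 6), inv_inv]
      ring
    have hm : (mu / eps) ^ (1 - β) = (eps / mu) ^ (β - 1) := by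
      rw [← inv_div, Real.inv_rpow (by positivity), ← Real.rpow_neg (by positivity), neg_sub]
    calc D ^ (-β) * _ ≤ D ^ (-β) * ((3 / c + 2 / (β - 1)) * (mu / eps) ^ (1 - β)) := by gcongr
      _ = _ := by
          rw [hDβ, hm]
          ring

end IsBorelCalculus

theorem proposition3p2 :
    ∃ (C₀ : ℝ≥0) (C₁ : ℝ → ℝ≥0) (C₂ : ℝ → ℝ → ℝ≥0),
    ∀ (X : Type*) [MeasurableSpace X] (ν : Measure X) [SigmaFinite ν]
      (A : Lp ℂ 2 ν →ₗ.[ℂ] Lp ℂ 2 ν) (_ : IsSelfAdjoint A)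
      (q q' : ℝ≥0∞) [ENNReal.HolderConjugate q q'] (_ : 2 < q) (_ : q < ∞)
      (lam eps : ℝ) (_ : 0 < eps) (_ : eps ≤ lam),
      opNormLp q' 2 (specProj A lam (lam + eps)) ≤
          C₀ * ENNReal.ofReal (eps * lam) *
            opNormLp q' 2 (specProj A 0 (2 * lam) *
              (ℑ (sqResolvent A ((lam + Complex.I * eps) ^ 2)) : Lp ℂ 2 ν →L[ℂ] Lp ℂ 2 ν)) ∧
      opNormLp q' 2 (specProj A 0 (2 * lam) * sqResolvent A ((lam + Complex.I * eps) ^ 2)) ≤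
          C₀ * ENNReal.ofReal ((eps * lam)⁻¹) * supCluster q' A lam eps ∧
      opNormLp q' 2 (specProj A lam (lam + eps)) ^ 2 ≤
          C₀ * ENNReal.ofReal (eps * lam) *
            opNormLp q' q (specProj A 0 (2 * lam) *
              (ℑ (sqResolvent A ((lam + Complex.I * eps) ^ 2)) : Lp ℂ 2 ν →L[ℂ] Lp ℂ 2 ν)) ∧
      opNormLp q' q (specProj A 0 (2 * lam) * sqResolvent A ((lam + Complex.I * eps) ^ 2)) ≤
          C₀ * ENNReal.ofReal ((eps * lam)⁻¹ * Real.log (bracket (lam / eps))) *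
            supCluster q' A lam eps ^ 2 ∧
      ∀ (c mu : ℝ) (_ : 0 < c) (_ : c * eps ≤ mu),
        opNormLp q' q (specProj A 0 (2 * lam) * sqResolvent A ((lam + Complex.I * mu) ^ 2)) ≤
            C₁ c * ENNReal.ofReal
              ((eps * lam)⁻¹ * (bracket (mu / lam))⁻¹ * Real.log (bracket (lam / mu))) *
              supCluster q' A lam eps ^ 2 ∧
        ∀ (β : ℝ) (_ : 1 < β),
          opNormLp q' q
              (specProj A 0 (2 * lam) * sqResolventPow A ((lam + Complex.I * mu) ^ 2) β) ≤
            C₂ c β * ENNReal.ofReal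
              ((eps * lam) ^ (-β) * (eps / mu) ^ (β - 1) * (bracket (mu / lam)) ^ (-β)) *
              supCluster q' A lam eps ^ 2 := by
  refine ⟨(60 : ℝ).toNNReal, fun c => (6 * (6 / c + 4)).toNNReal,
    fun c β => (6 ^ β * (3 / c + 2 / (β - 1))).toNNReal, ?_⟩
  intro X _ ν _ A _ q q' _ hq2 hq lam eps heps hle
  have hlam : 0 < lam := heps.trans_le hle
  by_cases hA : ∃ Φ, IsBorelCalculus A Φ
  swap
  -- The spectral theorem excludes this case, in which all the operators are zero by convention.
  · have h0 : ∀ f, borelCalculus A f = 0 := fun f => by simp [borelCalculus, hA]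
    simp [specProj, sqResolvent, sqResolventPow, h0]
  have hΦ := hA.choose_spec
  have hcalc : ∀ f, borelCalculus A f = hA.choose f := fun f => by simp [borelCalculus, hA]
  generalize hA.choose = Φ at hΦ hcalc
  simp only [supCluster, specProj, sqResolvent, sqResolventPow, hcalc]
  set S : ℝ≥0∞ := ⨆ (k : ℕ) (_ : (k : ℝ) ≤ 2 * lam / eps),
    opNormLp q' 2 (Φ ((Set.Icc (eps * k) (eps * (k + 1))).indicator fun _ => 1))
  have hcell : ∀ k : ℕ, (k : ℝ) ≤ 2 * lam / eps →
      opNormLp q' 2 (Φ ((Set.Icc (eps * k) (eps * (k + 1))).indicator fun _ => 1)) ≤ S :=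
    fun k hk => le_iSup₂_of_le k hk le_rfl
  have hq' : q' ≠ 0 := (zero_lt_one.trans_le (ENNReal.HolderConjugate.one_le q' q)).ne'
  have hmerge : ∀ {C : ℝ} (B : ℝ), 0 ≤ C →
      (C.toNNReal : ℝ≥0∞) * ENNReal.ofReal B = ENNReal.ofReal (C * B) :=
    fun B hC => (ENNReal.ofReal_mul hC).symm
  have hb : ∀ x, 2 ≤ bracket x := fun x => by simp [bracket]
  have hlog : ∀ x, 0 ≤ Real.log (bracket x) := fun x => Real.log_nonneg (by linarith [hb x])
  rw [hΦ.indicator_mul_imaginaryPart heps hlam,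
    hΦ.indicator_mul (isBddBorel_sqResolvent hlam heps) measurableSet_Icc]
  rw [hmerge _ (by norm_num), hmerge _ (by norm_num), hmerge _ (by norm_num)]
  refine ⟨?_, ?_, ?_, ?_, fun c mu hc hmu => ?_⟩
  · refine (hΦ.opNormLp_specProj_le q' heps hle).trans ?_
    gcongr
    norm_num
  · refine (hΦ.opNormLp_two_resolvent_le hq' heps hle hcell).trans ?_
    gcongr
    norm_num
  · refine (hΦ.opNormLp_specProj_sq_le q q' heps hle).trans ?_
    gcongr
    norm_num
  · refine (hΦ.opNormLp_dual_resolvent_le hq2.le hq.ne heps hlam one_pos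
      (one_mul eps).le hcell).trans ?_
    have h1 : (bracket (eps / lam))⁻¹ ≤ 1 := inv_le_one_of_one_le₀ (by linarith [hb (eps / lam)])
    have h2 := hlog (lam / eps)
    refine mul_le_mul_left (ENNReal.ofReal_le_ofReal ?_) _
    calc 6 * (6 / 1 + 4) *
          ((eps * lam)⁻¹ * (bracket (eps / lam))⁻¹ * Real.log (bracket (lam / eps)))
        ≤ 6 * (6 / 1 + 4) * ((eps * lam)⁻¹ * 1 * Real.log (bracket (lam / eps))) := by gcongr
      _ = _ := by ring
  · have hmu0 : 0 < mu := lt_of_lt_of_le (by positivity) hmu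
    refine ⟨?_, fun β hβ => ?_⟩
    · rw [hΦ.indicator_mul (isBddBorel_sqResolvent hlam hmu0) measurableSet_Icc,
        hmerge _ (by positivity)]
      exact hΦ.opNormLp_dual_resolvent_le hq2.le hq.ne heps hlam hc hmu hcell
    · have hβ1 : 0 < β - 1 := by linarith
      rw [hΦ.indicator_mul (isBddBorel_sqResolventPow hlam hmu0 (by linarith)) measurableSet_Icc,
        hmerge _ (by positivity)]
      exact hΦ.opNormLp_dual_resolventPow_le hq2.le hq.ne heps hlam hc hmu hβ hcell
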